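/- Let $d\ge 1$ and $P\in L^\infty(\mathbf R^d;\mathbf R)$, and let $S(t)=e^{-itP(D)}$, $D=-i\nabla_x$, be the associated unitary group, i.e. $S(t)u_0$ is obtained from $u_0$ by multiplying its Fourier transform by $e^{-itP(\xi)}$. Call a pair $(p,q)\neq(2,\infty)$ of exponents in $[2,\infty]^2$ admissible if $$\frac{2}{p}=d\left(\frac12-\frac1q\right)$$ (with $1/\infty=0$). Suppose that there exist an admissible pair $(p,q)$, an index $k\in\mathbf R$, a time interval $I\ni 0$ with $|I|>0$, and a constant $C>0$ such that $$\|S(\cdot)u_0\|_{L^p(I;L^q(\mathbf R^d))}\le C\|u_0\|_{H^k(\mathbf R^d)}\qquad\text{for all } u_0\in H^k(\mathbf R^d).$$ Then necessarily $k\ge \dfrac{2}{p}=\dfrac d2-\dfrac dq$. -/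

import Mathlib

open MeasureTheory FourierTransform TemperedDistribution
open scoped ENNReal SchwartzMap

noncomputable section

namespace ModifiedDispersion

/-- A pair of exponents `(p, q) ≠ (2, ∞)` in `[2, ∞]²` is admissible in dimension `d` if
`2 / p = d (1 / 2 - 1 / q)`, where `1 / ∞ = 0`. -/
structure IsAdmissible (d : ℕ) (p q : ℝ≥0∞) : Prop where
  two_le_left : 2 ≤ p
  two_le_right : 2 ≤ q
  ne_endpoint : (p, q) ≠ (2, ∞)
  scaling : 2 * (p⁻¹).toReal = d * (1 / 2 - (q⁻¹).toReal)

/-- The Sobolev space `H^k(ℝ^d)`, `k ∈ ℝ`, as a subspace of the tempered distributions. -/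
def SobolevH (d : ℕ) (k : ℝ) : Submodule ℂ 𝓢'(EuclideanSpace ℝ (Fin d), ℂ) where
  carrier := {u | MemSobolev k 2 u}
  add_mem' hu hv := hu.add hv
  zero_mem' := memSobolev_fun_zero _ _ k 2
  smul_mem' c _ hu := hu.smul c

/-- The (unique) `L²` function representing `J^k u` for `u ∈ H^k(ℝ^d)`, where `J^k` is the Bessel
potential operator of order `k`. -/
def besselL2 {d : ℕ} {k : ℝ} (u : SobolevH d k) :
    Lp ℂ 2 (volume : Measure (EuclideanSpace ℝ (Fin d))) :=
  Exists.choose (show MemSobolev k 2 (u : 𝓢'(EuclideanSpace ℝ (Fin d), ℂ)) from u.2)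

/-- The norm `‖u‖_{H^k} = ‖J^k u‖_{L²}`. With Mathlib's normalization `e^{-2πi x·ξ}` of the Fourier
transform, `J^k = (1 - Δ / (4π²))^{k/2}`; the norm is equivalent to the one given by
`(1 - Δ)^{k/2}`. -/
def sobolevNorm {d : ℕ} {k : ℝ} (u : SobolevH d k) : ℝ := ‖besselL2 u‖

/-- The symbol `ξ ↦ e^{-itP(2πξ)}` of `e^{-itP(D)}`, `D = -i∇`: with Mathlib's normalization
`e^{-2πi x·ξ}` of the Fourier transform, `D` is multiplication by `2πξ` on the Fourier side. -/
def phase {d : ℕ} (P : Lp ℝ ∞ (volume : Measure (EuclideanSpace ℝ (Fin d)))) (t : ℝ)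
    (ξ : EuclideanSpace ℝ (Fin d)) : ℂ :=
  Complex.exp (-(Complex.I * t * (P ((2 * Real.pi) • ξ) : ℝ)))

theorem phase_memLp {d : ℕ} (P : Lp ℝ ∞ (volume : Measure (EuclideanSpace ℝ (Fin d)))) (t : ℝ) :
    MemLp (phase P t) ∞ volume := by
  have hm : Measurable (phase P t) := by
    have h1 : Measurable fun ξ : EuclideanSpace ℝ (Fin d) ↦ P ((2 * Real.pi) • ξ) :=
      (Lp.stronglyMeasurable P).measurable.comp (measurable_const_smul _)
    unfold phase
    fun_prop
  refine memLp_top_of_bound hm.aestronglyMeasurable 1 (Filter.Eventually.of_forall fun ξ ↦ ?_)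
  simp [phase, Complex.norm_exp]

/-- The unitary operator `e^{-itP(D)}` on `L²(ℝ^d)`: multiplication by its symbol on the Fourier
side. -/
def groupL2 {d : ℕ} (P : Lp ℝ ∞ (volume : Measure (EuclideanSpace ℝ (Fin d)))) (t : ℝ)
    (f : Lp ℂ 2 (volume : Measure (EuclideanSpace ℝ (Fin d)))) :
    Lp ℂ 2 (volume : Measure (EuclideanSpace ℝ (Fin d))) :=
  𝓕⁻ ((phase_memLp P t).toLp (phase P t) • 𝓕 f :
    Lp ℂ 2 (volume : Measure (EuclideanSpace ℝ (Fin d))))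

/-- The free flow `S(t) u = e^{-itP(D)} u` of `u ∈ H^k(ℝ^d)`. Fourier multipliers commute, so it is
`J^{-k} e^{-itP(D)} J^k u` with `J^k u ∈ L²`; on the Fourier side this is multiplication of `û` by
the symbol of `e^{-itP(D)}`. -/
def freeFlow {d : ℕ} {k : ℝ} (P : Lp ℝ ∞ (volume : Measure (EuclideanSpace ℝ (Fin d)))) (t : ℝ)
    (u : SobolevH d k) : 𝓢'(EuclideanSpace ℝ (Fin d), ℂ) :=
  besselPotential (EuclideanSpace ℝ (Fin d)) ℂ (-k)
    (groupL2 P t (besselL2 u) : 𝓢'(EuclideanSpace ℝ (Fin d), ℂ))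

/-- The `L^q` norm of a tempered distribution: the `L^q` norm of the `L^q` function (unique up to
null sets) that represents it, and `∞` if there is no such function. -/
def lqNorm {d : ℕ} (q : ℝ≥0∞) (u : 𝓢'(EuclideanSpace ℝ (Fin d), ℂ)) : ℝ≥0∞ :=
  ⨅ (g : EuclideanSpace ℝ (Fin d) → ℂ)
    (_ : MemLp g q volume ∧ ∀ φ : 𝓢(EuclideanSpace ℝ (Fin d), ℂ), u φ = ∫ x, φ x * g x),
    eLpNorm g q volume

/-- The `L^p(I; L^q(ℝ^d))` norm of a distribution-valued function of time. -/
def strichartzNorm {d : ℕ} (p q : ℝ≥0∞) (I : Set ℝ)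
    (v : ℝ → 𝓢'(EuclideanSpace ℝ (Fin d), ℂ)) : ℝ≥0∞ :=
  eLpNorm (fun t ↦ lqNorm q (v t)) p (volume.restrict I)

end ModifiedDispersion

end

/-!
Multiplication by the bounded symbol `P` cannot disperse: for `|t - t₀| ‖P‖ ≤ 1` the phase
`e^{-i(t - t₀)P}` has real part at least `1 / 2`. Take data whose Fourier transform is, up to the
factor `e^{it₀P}`, a bump at frequencies of size `l` and of height `l ^ (-k)`. Their `H^k` norm is
of order `l ^ (d / 2)`, whereas for all `t` near `t₀` the pairing of `S(t) u` with the Fourier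
transform of a bump at the same frequencies, whose `L^{q'}` norm is of order `l ^ (d / q)`, is at
least of order `l ^ (d - k)`. So `‖S(t) u‖_{L^q}` is at least of order `l ^ (d - d / q - k)` on a
set of times of positive measure, independent of `l`. The estimate bounds this by a multiple of
`l ^ (d / 2)`, and `l → ∞` gives `d - d / q - k ≤ d / 2`.
-/

namespace ModifiedDispersion

section Exponents

theorem min_rpow_le_rpow {a x b : ℝ} (ha : 0 < a) (hax : a ≤ x) (hxb : x ≤ b) (s : ℝ) :
    min (a ^ s) (b ^ s) ≤ x ^ s := by
  rcases le_total 0 s with hs | hs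
  · exact (min_le_left _ _).trans (Real.rpow_le_rpow ha.le hax hs)
  · exact (min_le_right _ _).trans (Real.rpow_le_rpow_of_nonpos (ha.trans_le hax) hxb hs)

theorem exponent_le_of_forall_mul_rpow_le {a b s t : ℝ} (ha : 0 < a)
    (h : ∀ l : ℝ, 1 ≤ l → a * l ^ s ≤ b * l ^ t) : s ≤ t := by
  by_contra! hts
  have hlim := (tendsto_rpow_atTop (sub_pos.mpr hts)).const_mul_atTop ha
  obtain ⟨l, hbl, hl⟩ :=
    ((hlim.eventually_gt_atTop b).and (Filter.eventually_ge_atTop 1)).exists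
  have hl₀ : 0 < l := one_pos.trans_le hl
  refine (h l hl).not_gt ?_
  calc b * l ^ t < a * l ^ (s - t) * l ^ t := by gcongr
    _ = a * l ^ s := by rw [mul_assoc, ← Real.rpow_add hl₀, sub_add_cancel]

theorem toReal_inv_of_holderConjugate (q r : ℝ≥0∞) [r.HolderConjugate q] :
    (r⁻¹).toReal = 1 - (q⁻¹).toReal := by
  have hq : q⁻¹ ≤ 1 := ENNReal.inv_le_one.mpr (ENNReal.HolderConjugate.one_le q r)
  rw [← ENNReal.HolderConjugate.one_sub_inv q r, ENNReal.toReal_sub_of_le hq ENNReal.one_ne_top,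
    ENNReal.toReal_one]

end Exponents

section LowerBound

theorem mul_measure_rpow_le_eLpNorm {α : Type*} [MeasurableSpace α] {μ : Measure α} {p : ℝ≥0∞}
    (hp : p ≠ 0) {s : Set α} (hs : MeasurableSet s) (hμs : μ s ≠ 0) {g : α → ℝ≥0∞} {a : ℝ≥0∞}
    (h : ∀ t ∈ s, a ≤ g t) : a * μ s ^ (1 / p.toReal) ≤ eLpNorm g p μ := by
  calc a * μ s ^ (1 / p.toReal) = eLpNorm (s.indicator fun _ ↦ a) p μ := by
        rw [eLpNorm_indicator_const' hs hμs hp, enorm_eq_self]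
    _ ≤ eLpNorm g p μ := eLpNorm_mono_enorm fun t ↦ by
        simpa only [enorm_eq_self] using Set.indicator_apply_le fun ht ↦ h t ht

theorem exists_measurableSet_restrict_ne_zero_abs_sub_mul_le_one {I : Set ℝ} (hI : volume I ≠ 0)
    {b : ℝ} (hb : 0 ≤ b) :
    ∃ t₀ : ℝ, ∃ J : Set ℝ, MeasurableSet J ∧ volume.restrict I J ≠ 0 ∧ volume.restrict I J ≠ ∞ ∧
      ∀ t ∈ J, |t - t₀| * b ≤ 1 := by
  obtain ⟨t₀, -, ht₀⟩ := exists_mem_forall_mem_nhdsWithin_pos_measure hI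
  have hδ : 0 < (b + 1)⁻¹ := by positivity
  let J := Metric.closedBall t₀ (b + 1)⁻¹
  have hJ : MeasurableSet J := Metric.isClosed_closedBall.measurableSet
  refine ⟨t₀, J, hJ, ?_, ?_, fun t ht ↦ ?_⟩
  · rw [Measure.restrict_apply hJ]
    exact (ht₀ _ (Filter.inter_mem
      (mem_nhdsWithin_of_mem_nhds (Metric.closedBall_mem_nhds t₀ hδ)) self_mem_nhdsWithin)).ne'
  · exact ((Measure.restrict_apply_le I J).trans_lt measure_closedBall_lt_top).ne
  · calc |t - t₀| * b ≤ (b + 1)⁻¹ * (b + 1) := by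
          gcongr
          · exact ht
          · linarith
      _ = 1 := inv_mul_cancel₀ (by positivity)

end LowerBound

section Dilation

variable {E F : Type*} [NormedAddCommGroup E] [NormedAddCommGroup F]

theorem eLpNorm_comp_smul [NormedSpace ℝ E] [FiniteDimensional ℝ E] [MeasurableSpace E]
    [BorelSpace E] (μ : Measure E) [μ.IsAddHaarMeasure] {l : ℝ} (hl : l ≠ 0) (r : ℝ≥0∞)
    (f : E → F) :
    eLpNorm (fun x ↦ f (l • x)) r μ =
      ENNReal.ofReal (|l| ^ (-(Module.finrank ℝ E * (r⁻¹).toReal))) * eLpNorm f r μ := by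
  have hscale : 0 < |(l ^ Module.finrank ℝ E)⁻¹| := by positivity
  have hmap := (Homeomorph.smulOfNeZero l hl).measurableEmbedding.eLpNorm_map_measure
    (μ := μ) (p := r) (g := f)
  have hscale_rpow : |(l ^ Module.finrank ℝ E)⁻¹| ^ (r⁻¹).toReal =
      |l| ^ (-(Module.finrank ℝ E * (r⁻¹).toReal)) := by
    rw [abs_inv, abs_pow, Real.inv_rpow (by positivity), Real.rpow_neg (by positivity),
      Real.rpow_mul (by positivity), Real.rpow_natCast]
  calc eLpNorm (fun x ↦ f (l • x)) r μ = eLpNorm f r (μ.map (l • ·)) := hmap.symm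
    _ = ENNReal.ofReal (|l| ^ (-(Module.finrank ℝ E * (r⁻¹).toReal))) * eLpNorm f r μ := by
      rw [Measure.map_addHaar_smul μ hl, eLpNorm_smul_measure_of_ne_zero
        (ENNReal.ofReal_pos.mpr hscale).ne', ENNReal.ofReal_rpow_of_pos hscale, one_div,
        hscale_rpow, smul_eq_mul]

variable [InnerProductSpace ℝ E] [NormedSpace ℂ F] {l : ℝ}

/-- The dilate `x ↦ f (l⁻¹ x)` of a Schwartz function `f`; it carries frequencies of size `1` to
frequencies of size `l`. -/
noncomputable def dilate (hl : l ≠ 0) (f : 𝓢(E, F)) : 𝓢(E, F) :=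
  SchwartzMap.compCLMOfContinuousLinearEquiv ℂ
    (ContinuousLinearEquiv.smulLeft (Units.mk0 l⁻¹ (inv_ne_zero hl))) f

theorem dilate_apply (hl : l ≠ 0) (f : 𝓢(E, F)) (x : E) : dilate hl f x = f (l⁻¹ • x) := rfl

variable [FiniteDimensional ℝ E] [MeasurableSpace E] [BorelSpace E]

theorem eLpNorm_dilate (hl : l ≠ 0) (f : 𝓢(E, F)) (r : ℝ≥0∞) :
    eLpNorm (dilate hl f) r volume =
      ENNReal.ofReal (|l| ^ (Module.finrank ℝ E * (r⁻¹).toReal)) * eLpNorm f r volume := by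
  have h := eLpNorm_comp_smul volume (inv_ne_zero hl) r f
  rwa [abs_inv, Real.inv_rpow (abs_nonneg l), Real.rpow_neg (abs_nonneg l), inv_inv] at h

theorem fourier_dilate_apply (hl : l ≠ 0) (f : 𝓢(E, F)) (x : E) :
    𝓕 (dilate hl f) x = (|l| ^ Module.finrank ℝ E : ℝ) • 𝓕 f (l • x) := by
  have hsubst := Measure.integral_comp_inv_smul (volume : Measure E)
    (fun v ↦ Complex.exp (↑(-2 * Real.pi * inner ℝ v (l • x)) * Complex.I) • f v) l
  have hinner (v : E) : inner ℝ (l⁻¹ • v) (l • x) = inner ℝ v x := by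
    rw [real_inner_smul_left, real_inner_smul_right, inv_mul_cancel_left₀ hl]
  simp only [hinner, abs_pow] at hsubst
  simpa only [SchwartzMap.fourier_coe, Real.fourier_eq', dilate_apply] using hsubst

theorem eLpNorm_fourier_dilate (hl : l ≠ 0) (f : 𝓢(E, F)) (r : ℝ≥0∞) :
    eLpNorm (𝓕 (dilate hl f) : 𝓢(E, F)) r volume =
      ENNReal.ofReal (|l| ^ (Module.finrank ℝ E * (1 - (r⁻¹).toReal))) *
        eLpNorm (𝓕 f : 𝓢(E, F)) r volume := by
  have hcoe : ⇑(𝓕 (dilate hl f) : 𝓢(E, F)) =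
      (|l| ^ Module.finrank ℝ E : ℝ) • fun x ↦ (𝓕 f : 𝓢(E, F)) (l • x) :=
    funext (fourier_dilate_apply hl f)
  rw [hcoe, eLpNorm_const_smul, eLpNorm_comp_smul volume hl, ← mul_assoc,
    Real.enorm_eq_ofReal (by positivity), ← ENNReal.ofReal_mul (by positivity),
    ← Real.rpow_natCast, ← Real.rpow_add (abs_pos.mpr hl)]
  ring_nf

end Dilation

section Schwartz

variable {E F : Type*} [NormedAddCommGroup E] [NormedAddCommGroup F] [NormedSpace ℝ F]

section Norm

variable [NormedSpace ℝ E] [FiniteDimensional ℝ E] [MeasurableSpace E] [BorelSpace E]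
  {μ : Measure E} [μ.IsOpenPosMeasure] {r : ℝ≥0∞} {f : 𝓢(E, F)}

theorem eLpNorm_schwartz_eq_zero_iff (hr : r ≠ 0) : eLpNorm f r μ = 0 ↔ f = 0 := by
  rw [eLpNorm_eq_zero_iff f.continuous.aestronglyMeasurable hr,
    f.continuous.ae_eq_iff_eq μ continuous_zero, ← FunLike.coe_zero (F := 𝓢(E, F)),
    DFunLike.coe_fn_eq]

theorem toReal_eLpNorm_schwartz_pos [μ.HasTemperateGrowth] (hr : r ≠ 0) (hf : f ≠ 0) :
    0 < (eLpNorm f r μ).toReal :=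
  ENNReal.toReal_pos (mt (eLpNorm_schwartz_eq_zero_iff hr).mp hf) (f.memLp r μ).eLpNorm_ne_top

theorem integral_norm_sq_schwartz_pos [μ.HasTemperateGrowth] (hf : f ≠ 0) :
    0 < ∫ x, ‖f x‖ ^ 2 ∂μ := by
  obtain ⟨x, hx⟩ := DFunLike.ne_iff.mp hf
  exact integral_pos_of_integrable_nonneg_nonzero (x := x) (f.continuous.norm.pow 2)
    ((f.memLp 2 μ).integrable_norm_pow two_ne_zero) (fun _ ↦ sq_nonneg _)
    (pow_ne_zero 2 (norm_ne_zero_iff.mpr hx))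

end Norm

theorem exists_schwartz_annulus (E : Type*) [NormedAddCommGroup E] [InnerProductSpace ℝ E]
    [FiniteDimensional ℝ E] [Nontrivial E] :
    ∃ χ : 𝓢(E, ℂ), χ ≠ 0 ∧ ∀ x, χ x ≠ 0 → 1 ≤ ‖x‖ ∧ ‖x‖ ≤ 3 := by
  obtain ⟨e, he⟩ := exists_norm_eq E zero_le_two
  let f : ContDiffBump e := ⟨1 / 2, 1, by norm_num, by norm_num⟩
  have hsupp : HasCompactSupport (fun x ↦ (f x : ℂ)) :=
    f.hasCompactSupport.comp_left (g := fun y : ℝ ↦ (y : ℂ)) Complex.ofReal_zero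
  have hsmooth : ContDiff ℝ (⊤ : ℕ∞) (fun x ↦ (f x : ℂ)) :=
    Complex.ofRealCLM.contDiff.comp f.contDiff
  refine ⟨hsupp.toSchwartzMap hsmooth, fun h ↦ ?_, fun x hx ↦ ?_⟩
  · have hfe : f e = 1 := f.one_of_mem_closedBall (Metric.mem_closedBall_self f.rIn_pos.le)
    simpa [hfe] using DFunLike.congr_fun h e
  · have hx' : x ∈ Function.support f := Complex.ofReal_ne_zero.mp hx
    rw [f.support_eq, mem_ball_iff_norm] at hx'
    have hsub := abs_le.mp ((abs_norm_sub_norm_le x e).trans hx'.le)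
    constructor <;> linarith

/-- The pointwise complex conjugate of a Schwartz function, the test function against which the wave
packets are paired. -/
noncomputable def conjSchwartz [NormedSpace ℝ E] (f : 𝓢(E, ℂ)) : 𝓢(E, ℂ) :=
  f.postcompCLM (Complex.conjCLE : ℂ →L[ℝ] ℂ)

theorem conjSchwartz_apply [NormedSpace ℝ E] (f : 𝓢(E, ℂ)) (x : E) :
    conjSchwartz f x = starRingEnd ℂ (f x) := rfl

theorem conjSchwartz_ne_zero [NormedSpace ℝ E] {f : 𝓢(E, ℂ)} (hf : f ≠ 0) :
    conjSchwartz f ≠ 0 := fun h ↦ hf <| by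
  ext x
  exact (map_eq_zero (starRingEnd ℂ)).mp (DFunLike.congr_fun h x)

theorem fourier_schwartz_ne_zero [InnerProductSpace ℝ E] [FiniteDimensional ℝ E]
    [MeasurableSpace E] [BorelSpace E] {f : 𝓢(E, ℂ)} (hf : f ≠ 0) : (𝓕 f : 𝓢(E, ℂ)) ≠ 0 :=
  fun h ↦ hf <| by
    rw [← fourierInv_fourier_eq (F := 𝓢(E, ℂ)) f, h]
    exact map_zero (fourierInvCLM ℂ 𝓢(E, ℂ))

end Schwartz

section BesselSymbol

variable {E : Type*} [NormedAddCommGroup E]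

/-- The symbol `(1 + ‖ξ‖ ^ 2) ^ (s / 2)` of the Bessel potential operator of order `s`, in Mathlib's
normalization of the Fourier transform. -/
noncomputable def besselSymbol (s : ℝ) (ξ : E) : ℝ := (1 + ‖ξ‖ ^ 2) ^ (s / 2)

theorem besselSymbol_nonneg (s : ℝ) (ξ : E) : 0 ≤ besselSymbol s ξ := by
  unfold besselSymbol
  positivity

theorem min_mul_rpow_le_besselSymbol_smul [NormedSpace ℝ E] (s : ℝ) {l : ℝ} (hl : 1 ≤ l) {x : E}
    (hx₁ : 1 ≤ ‖x‖) (hx₃ : ‖x‖ ≤ 3) :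
    min 1 (10 ^ (s / 2)) * l ^ s ≤ besselSymbol s (l • x) := by
  have hl₀ : 0 < l := one_pos.trans_le hl
  have hnorm : ‖l • x‖ ^ 2 = l ^ 2 * ‖x‖ ^ 2 := by
    rw [norm_smul, mul_pow, Real.norm_of_nonneg hl₀.le]
  have hlower : l ^ 2 ≤ 1 + ‖l • x‖ ^ 2 := by
    rw [hnorm]
    nlinarith [one_le_pow₀ hx₁ (n := 2), sq_nonneg l]
  have hupper : 1 + ‖l • x‖ ^ 2 ≤ 10 * l ^ 2 := by
    rw [hnorm]
    nlinarith [one_le_pow₀ hl (n := 2), pow_le_pow_left₀ (norm_nonneg x) hx₃ 2, sq_nonneg l]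
  have hrpow : (l ^ 2) ^ (s / 2) = l ^ s := by
    rw [← Real.rpow_natCast_mul hl₀.le]
    congr 1
    push_cast
    ring
  calc min 1 (10 ^ (s / 2)) * l ^ s = min ((l ^ 2) ^ (s / 2)) ((10 * l ^ 2) ^ (s / 2)) := by
        rw [Real.mul_rpow (by norm_num) (sq_nonneg l), hrpow,
          min_mul_of_nonneg _ _ (by positivity), one_mul]
    _ ≤ besselSymbol s (l • x) := min_rpow_le_rpow (by positivity) hlower hupper _

variable [InnerProductSpace ℝ E]

theorem hasTemperateGrowth_ofReal_besselSymbol (s : ℝ) :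
    (fun ξ : E ↦ (besselSymbol s ξ : ℂ)).HasTemperateGrowth := by
  unfold besselSymbol
  fun_prop

variable [FiniteDimensional ℝ E] [MeasurableSpace E] [BorelSpace E]

theorem integrable_besselSymbol_mul_norm_sq (s : ℝ) (χ : 𝓢(E, ℂ)) :
    Integrable fun ξ ↦ besselSymbol s ξ * ‖χ ξ‖ ^ 2 := by
  have hL2 := ((SchwartzMap.smulLeftCLM ℂ (fun ξ : E ↦ (besselSymbol s ξ : ℂ)) χ).memLp 2
    volume).integrable_mul (χ.memLp 2 volume)
  refine hL2.norm.congr (.of_forall fun ξ ↦ ?_)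
  simp only [Pi.mul_apply, SchwartzMap.smulLeftCLM_apply_apply
    (hasTemperateGrowth_ofReal_besselSymbol s), smul_eq_mul, norm_mul, Complex.norm_real,
    Real.norm_of_nonneg (besselSymbol_nonneg s ξ)]
  ring

theorem mul_rpow_le_integral_besselSymbol_mul_dilate (s : ℝ) {l : ℝ} (hl : 1 ≤ l)
    {χ : 𝓢(E, ℂ)} (hχ : ∀ x, χ x ≠ 0 → 1 ≤ ‖x‖ ∧ ‖x‖ ≤ 3) :
    min 1 (10 ^ (s / 2)) * (∫ x, ‖χ x‖ ^ 2) * l ^ (Module.finrank ℝ E + s) ≤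
      ∫ ξ, besselSymbol s ξ * ‖dilate (one_pos.trans_le hl).ne' χ ξ‖ ^ 2 := by
  have hl₀ : 0 < l := one_pos.trans_le hl
  have hpointwise (ξ : E) : min 1 (10 ^ (s / 2)) * l ^ s * ‖χ (l⁻¹ • ξ)‖ ^ 2 ≤
      besselSymbol s ξ * ‖dilate hl₀.ne' χ ξ‖ ^ 2 := by
    rw [dilate_apply]
    by_cases hzero : χ (l⁻¹ • ξ) = 0
    · simp [hzero]
    · obtain ⟨hx₁, hx₃⟩ := hχ _ hzero
      gcongr
      simpa only [smul_inv_smul₀ hl₀.ne'] using min_mul_rpow_le_besselSymbol_smul s hl hx₁ hx₃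
  have hsq : Integrable fun x ↦ ‖χ x‖ ^ 2 :=
    (χ.memLp 2 volume).integrable_norm_pow two_ne_zero
  calc min 1 (10 ^ (s / 2)) * (∫ x, ‖χ x‖ ^ 2) * l ^ (Module.finrank ℝ E + s)
      = ∫ ξ, min 1 (10 ^ (s / 2)) * l ^ s * ‖χ (l⁻¹ • ξ)‖ ^ 2 := by
        rw [integral_const_mul, Measure.integral_comp_inv_smul volume (fun x ↦ ‖χ x‖ ^ 2) l,
          abs_of_pos (by positivity), smul_eq_mul, Real.rpow_add hl₀, Real.rpow_natCast]
        ring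
    _ ≤ ∫ ξ, besselSymbol s ξ * ‖dilate hl₀.ne' χ ξ‖ ^ 2 :=
        integral_mono ((hsq.comp_smul (inv_ne_zero hl₀.ne')).const_mul _)
          (integrable_besselSymbol_mul_norm_sq s _) hpointwise

end BesselSymbol

variable {d : ℕ}

local notation "𝔼" n:max => EuclideanSpace ℝ (Fin n)

section Phase

variable (P : Lp ℝ ∞ (volume : Measure (𝔼 d)))

theorem norm_phase (t : ℝ) (ξ : 𝔼 d) : ‖phase P t ξ‖ = 1 := by
  simp [phase, Complex.norm_exp]

theorem phase_add (s t : ℝ) (ξ : 𝔼 d) : phase P (s + t) ξ = phase P s ξ * phase P t ξ := by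
  rw [phase, phase, phase, ← Complex.exp_add]
  push_cast
  ring_nf

theorem re_phase (t : ℝ) (ξ : 𝔼 d) : (phase P t ξ).re = Real.cos (t * P ((2 * Real.pi) • ξ)) := by
  have harg : -(Complex.I * t * (P ((2 * Real.pi) • ξ) : ℝ)) =
      ((-(t * P ((2 * Real.pi) • ξ)) : ℝ) : ℂ) * Complex.I := by
    push_cast
    ring
  rw [phase, harg, Complex.exp_ofReal_mul_I_re, Real.cos_neg]

theorem ae_norm_apply_two_pi_smul_le : ∀ᵐ ξ : 𝔼 d, ‖P ((2 * Real.pi) • ξ)‖ ≤ ‖P‖ := by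
  have hP : ∀ᵐ ξ, ‖P ξ‖ ≤ ‖P‖ := by
    filter_upwards [enorm_ae_le_eLpNormEssSup P (volume : Measure (𝔼 d))] with ξ hξ
    rw [← eLpNorm_exponent_top, ← Lp.enorm_def] at hξ
    exact enorm_le_iff_norm_le.mp hξ
  exact (Measure.quasiMeasurePreserving_smul volume (r := 2 * Real.pi) (by positivity)).ae hP

theorem ae_half_le_re_phase {t : ℝ} (ht : |t| * ‖P‖ ≤ 1) :
    ∀ᵐ ξ, 1 / 2 ≤ (phase P t ξ).re := by
  filter_upwards [ae_norm_apply_two_pi_smul_le P] with ξ hξ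
  have hangle : |t * P ((2 * Real.pi) • ξ)| ≤ 1 := by
    rw [abs_mul]
    exact (mul_le_mul_of_nonneg_left hξ (abs_nonneg t)).trans ht
  have hcos := Real.one_sub_sq_div_two_le_cos (x := t * P ((2 * Real.pi) • ξ))
  have hsq := (sq_le_one_iff_abs_le_one _).mpr hangle
  rw [re_phase]
  linarith

theorem half_integral_le_norm_integral_mul_phase {t : ℝ} (ht : |t| * ‖P‖ ≤ 1) {g : 𝔼 d → ℝ}
    (hg : Integrable g) (hg₀ : ∀ ξ, 0 ≤ g ξ) :
    1 / 2 * ∫ ξ, g ξ ≤ ‖∫ ξ, g ξ * phase P t ξ‖ := by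
  have hint : Integrable fun ξ ↦ (g ξ : ℂ) * phase P t ξ :=
    hg.ofReal.mul_of_top_left (phase_memLp P t)
  calc 1 / 2 * ∫ ξ, g ξ = ∫ ξ, 1 / 2 * g ξ := (integral_const_mul _ _).symm
    _ ≤ ∫ ξ, (g ξ * phase P t ξ).re := by
      refine integral_mono_ae (hg.const_mul _) hint.re ?_
      filter_upwards [ae_half_le_re_phase P ht] with ξ hξ
      rw [Complex.re_ofReal_mul, mul_comm]
      exact mul_le_mul_of_nonneg_left hξ (hg₀ ξ)
    _ = (∫ ξ, g ξ * phase P t ξ).re := integral_re hint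
    _ ≤ ‖∫ ξ, g ξ * phase P t ξ‖ := Complex.re_le_norm _

end Phase

section FreeFlow

variable {k : ℝ}

theorem besselPotential_eq_besselL2 (u : SobolevH d k) :
    besselPotential (𝔼 d) ℂ k (u : 𝓢'(𝔼 d, ℂ)) = (besselL2 u : 𝓢'(𝔼 d, ℂ)) :=
  Exists.choose_spec (show MemSobolev k 2 (u : 𝓢'(𝔼 d, ℂ)) from u.2)

theorem exists_besselL2_eq (k : ℝ) (f : Lp ℂ 2 (volume : Measure (𝔼 d))) :
    ∃ u : SobolevH d k, besselL2 u = f := by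
  have hf : besselPotential (𝔼 d) ℂ k (besselPotential (𝔼 d) ℂ (-k) (f : 𝓢'(𝔼 d, ℂ))) = f := by simp
  refine ⟨⟨besselPotential (𝔼 d) ℂ (-k) f, f, hf⟩, ?_⟩
  have hinj := LinearMap.ker_eq_bot.mp
    (Lp.ker_toTemperedDistributionCLM_eq_bot (E := 𝔼 d) (F := ℂ) (p := 2) (μ := volume))
  exact hinj ((besselPotential_eq_besselL2 _).symm.trans hf)

theorem exists_fourier_besselL2_ae_eq (k : ℝ) {f : 𝔼 d → ℂ} (hf : MemLp f 2) :
    ∃ u : SobolevH d k, (𝓕 (besselL2 u) : Lp ℂ 2 (volume : Measure (𝔼 d))) =ᵐ[volume] f := by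
  obtain ⟨u, hu⟩ := exists_besselL2_eq k (𝓕⁻ (hf.toLp f))
  refine ⟨u, ?_⟩
  rw [hu, fourier_fourierInv_eq]
  exact hf.coeFn_toLp

theorem sobolevNorm_eq_of_fourier_ae_eq {u : SobolevH d k} {f : 𝔼 d → ℂ}
    (hu : (𝓕 (besselL2 u) : Lp ℂ 2 (volume : Measure (𝔼 d))) =ᵐ[volume] f) :
    sobolevNorm u = (eLpNorm f 2 volume).toReal := by
  rw [sobolevNorm, ← Lp.norm_fourier_eq, Lp.norm_def, eLpNorm_congr_ae hu]

theorem freeFlow_fourier_apply (P : Lp ℝ ∞ (volume : Measure (𝔼 d))) (t : ℝ) (u : SobolevH d k)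
    (ψ : 𝓢(𝔼 d, ℂ)) :
    freeFlow P t u (𝓕 ψ) = ∫ ξ, (besselSymbol (-k) ξ * ψ ξ) *
      (phase P t ξ * (𝓕 (besselL2 u) : Lp ℂ 2 (volume : Measure (𝔼 d))) ξ) := by
  rw [← TemperedDistribution.fourier_apply, freeFlow,
    fourier_besselPotential_eq_smulLeftCLM_fourier_apply, smulLeftCLM_apply_apply,
    Lp.fourier_toTemperedDistribution_eq, groupL2, fourier_fourierInv_eq,
    Lp.toTemperedDistribution_apply]
  refine integral_congr_ae ?_
  filter_upwards [Lp.coeFn_lpSMul (r := 2) ((phase_memLp P t).toLp (phase P t))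
    (𝓕 (besselL2 u)), (phase_memLp P t).coeFn_toLp] with ξ hsmul hphase
  rw [hsmul, Pi.smul_apply', hphase, SchwartzMap.smulLeftCLM_apply_apply (by fun_prop)]
  rfl

theorem enorm_apply_le_eLpNorm_mul_lqNorm (q r : ℝ≥0∞) [r.HolderConjugate q] (u : 𝓢'(𝔼 d, ℂ))
    (φ : 𝓢(𝔼 d, ℂ)) : ‖u φ‖ₑ ≤ eLpNorm φ r volume * lqNorm q u := by
  rcases eq_or_ne φ 0 with rfl | hφ
  · simp
  have hφ₀ : eLpNorm φ r volume ≠ 0 :=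
    mt (eLpNorm_schwartz_eq_zero_iff (ENNReal.HolderConjugate.ne_zero r q)).mp hφ
  have hφ_top : eLpNorm φ r volume ≠ ∞ := (φ.memLp r volume).eLpNorm_ne_top
  rw [mul_comm, ← ENNReal.div_le_iff hφ₀ hφ_top]
  refine le_iInf₂ fun g ⟨hg, hu⟩ ↦ ?_
  rw [ENNReal.div_le_iff hφ₀ hφ_top, mul_comm, hu φ]
  calc ‖∫ x, φ x * g x‖ₑ ≤ ∫⁻ x, ‖φ x * g x‖ₑ := enorm_integral_le_lintegral_enorm _
    _ = eLpNorm (⇑φ • g) 1 volume := eLpNorm_one_eq_lintegral_enorm.symm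
    _ ≤ eLpNorm φ r volume * eLpNorm g q volume :=
      eLpNorm_smul_le_mul_eLpNorm hg.1 (φ.memLp r volume).1

theorem ofReal_mul_rpow_le_lqNorm_of_le_norm_fourier_dilate {q r : ℝ≥0∞} [r.HolderConjugate q]
    {l : ℝ} (hl : 0 < l) {v : 𝓢'(𝔼 d, ℂ)} {ψ : 𝓢(𝔼 d, ℂ)} (hψ : ψ ≠ 0) {a s : ℝ}
    (hv : a * l ^ s ≤ ‖v (𝓕 (dilate hl.ne' ψ))‖) :
    ENNReal.ofReal (a / (eLpNorm (𝓕 ψ : 𝓢(𝔼 d, ℂ)) r volume).toReal *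
      l ^ (s - d * (q⁻¹).toReal)) ≤ lqNorm q v := by
  set b := (eLpNorm (𝓕 ψ : 𝓢(𝔼 d, ℂ)) r volume).toReal
  have hb : 0 < b := toReal_eLpNorm_schwartz_pos (ENNReal.HolderConjugate.ne_zero r q)
    (fourier_schwartz_ne_zero hψ)
  have hnorm : eLpNorm (𝓕 (dilate hl.ne' ψ) : 𝓢(𝔼 d, ℂ)) r volume =
      ENNReal.ofReal (l ^ (d * (q⁻¹).toReal) * b) := by
    rw [eLpNorm_fourier_dilate, abs_of_pos hl, finrank_euclideanSpace_fin,
      toReal_inv_of_holderConjugate q r, sub_sub_cancel, ENNReal.ofReal_mul (by positivity),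
      ENNReal.ofReal_toReal ((𝓕 ψ : 𝓢(𝔼 d, ℂ)).memLp r volume).eLpNorm_ne_top]
  have hholder := enorm_apply_le_eLpNorm_mul_lqNorm q r v (𝓕 (dilate hl.ne' ψ))
  rw [hnorm, mul_comm] at hholder
  calc ENNReal.ofReal (a / b * l ^ (s - d * (q⁻¹).toReal))
      = ENNReal.ofReal (a * l ^ s) / ENNReal.ofReal (l ^ (d * (q⁻¹).toReal) * b) := by
        rw [← ENNReal.ofReal_div_of_pos (by positivity), Real.rpow_sub hl]
        congr 1
        field_simp
    _ ≤ ‖v (𝓕 (dilate hl.ne' ψ))‖ₑ / ENNReal.ofReal (l ^ (d * (q⁻¹).toReal) * b) := by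
        rw [← ofReal_norm]
        gcongr
    _ ≤ lqNorm q v := ENNReal.div_le_of_le_mul hholder

end FreeFlow

section WavePacket

variable {P : Lp ℝ ∞ (volume : Measure (𝔼 d))} {k t₀ : ℝ} {u : SobolevH d k} {χ : 𝓢(𝔼 d, ℂ)}

theorem half_integral_le_norm_freeFlow_fourier_conjSchwartz
    (hu : (𝓕 (besselL2 u) : Lp ℂ 2 (volume : Measure (𝔼 d))) =ᵐ[volume]
      fun ξ ↦ phase P (-t₀) ξ * χ ξ) {t : ℝ} (ht : |t - t₀| * ‖P‖ ≤ 1) :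
    1 / 2 * ∫ ξ, besselSymbol (-k) ξ * ‖χ ξ‖ ^ 2 ≤
      ‖freeFlow P t u (𝓕 (conjSchwartz χ))‖ := by
  have hpairing : freeFlow P t u (𝓕 (conjSchwartz χ)) =
      ∫ ξ, (besselSymbol (-k) ξ * ‖χ ξ‖ ^ 2 : ℝ) * phase P (t - t₀) ξ := by
    rw [freeFlow_fourier_apply]
    refine integral_congr_ae ?_
    filter_upwards [hu] with ξ hξ
    rw [hξ, sub_eq_add_neg, phase_add, Complex.ofReal_mul, Complex.ofReal_pow,
      ← Complex.conj_mul', conjSchwartz_apply]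
    ring
  rw [hpairing]
  exact half_integral_le_norm_integral_mul_phase P ht (integrable_besselSymbol_mul_norm_sq _ χ)
    fun ξ ↦ mul_nonneg (besselSymbol_nonneg _ ξ) (sq_nonneg _)

theorem sobolevNorm_eq_of_fourier_ae_eq_phase_mul_dilate {l : ℝ} (hl₀ : l ≠ 0)
    (hu : (𝓕 (besselL2 u) : Lp ℂ 2 (volume : Measure (𝔼 d))) =ᵐ[volume]
      fun ξ ↦ phase P (-t₀) ξ * dilate hl₀ χ ξ) :
    sobolevNorm u = (eLpNorm χ 2 volume).toReal * |l| ^ ((d : ℝ) / 2) := by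
  have hnorm : eLpNorm (fun ξ ↦ phase P (-t₀) ξ * dilate hl₀ χ ξ) 2 volume =
      eLpNorm (dilate hl₀ χ) 2 volume :=
    eLpNorm_congr_norm_ae (.of_forall fun ξ ↦ by rw [norm_mul, norm_phase, one_mul])
  rw [sobolevNorm_eq_of_fourier_ae_eq hu, hnorm, eLpNorm_dilate, ENNReal.toReal_mul,
    ENNReal.toReal_ofReal (by positivity), finrank_euclideanSpace_fin, mul_comm,
    ENNReal.toReal_inv, ENNReal.toReal_ofNat, ← div_eq_mul_inv]

theorem mul_rpow_le_norm_freeFlow_fourier_dilate_conjSchwartz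
    (hχ : ∀ x, χ x ≠ 0 → 1 ≤ ‖x‖ ∧ ‖x‖ ≤ 3) {l : ℝ} (hl : 1 ≤ l)
    (hu : (𝓕 (besselL2 u) : Lp ℂ 2 (volume : Measure (𝔼 d))) =ᵐ[volume]
      fun ξ ↦ phase P (-t₀) ξ * dilate (one_pos.trans_le hl).ne' χ ξ) {t : ℝ}
    (ht : |t - t₀| * ‖P‖ ≤ 1) :
    1 / 2 * (min 1 (10 ^ (-k / 2)) * ∫ x, ‖χ x‖ ^ 2) * l ^ (d - k) ≤
      ‖freeFlow P t u (𝓕 (dilate (one_pos.trans_le hl).ne' (conjSchwartz χ)))‖ := by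
  have hweight := mul_rpow_le_integral_besselSymbol_mul_dilate (-k) hl hχ
  rw [finrank_euclideanSpace_fin, ← sub_eq_add_neg] at hweight
  calc 1 / 2 * (min 1 (10 ^ (-k / 2)) * ∫ x, ‖χ x‖ ^ 2) * l ^ (d - k)
      ≤ 1 / 2 * ∫ ξ, besselSymbol (-k) ξ * ‖dilate (one_pos.trans_le hl).ne' χ ξ‖ ^ 2 := by
        rw [mul_assoc]
        gcongr
    _ ≤ _ := half_integral_le_norm_freeFlow_fourier_conjSchwartz hu ht

theorem exists_sobolevNorm_eq_and_le_lqNorm_freeFlow (hd : 1 ≤ d)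
    (P : Lp ℝ ∞ (volume : Measure (𝔼 d))) (k : ℝ) {q : ℝ≥0∞} (hq : 1 ≤ q) (t₀ : ℝ) :
    ∃ a > 0, ∃ M : ℝ, ∀ l : ℝ, 1 ≤ l → ∃ u : SobolevH d k,
      sobolevNorm u = M * l ^ ((d : ℝ) / 2) ∧ ∀ t, |t - t₀| * ‖P‖ ≤ 1 →
        ENNReal.ofReal (a * l ^ (d - k - d * (q⁻¹).toReal)) ≤ lqNorm q (freeFlow P t u) := by
  have : Nonempty (Fin d) := ⟨⟨0, hd⟩⟩
  obtain ⟨r, hr⟩ : ∃ r : ℝ≥0∞, r.HolderConjugate q :=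
    ⟨q.conjExponent, (ENNReal.HolderConjugate.conjExponent hq).symm⟩
  obtain ⟨χ, hχ₀, hχ⟩ := exists_schwartz_annulus (𝔼 d)
  let ψ := conjSchwartz χ
  have hψ : ψ ≠ 0 := conjSchwartz_ne_zero hχ₀
  have hψ_pos : 0 < (eLpNorm (𝓕 ψ : 𝓢(𝔼 d, ℂ)) r volume).toReal :=
    toReal_eLpNorm_schwartz_pos (ENNReal.HolderConjugate.ne_zero r q) (fourier_schwartz_ne_zero hψ)
  have hχ_pos : 0 < ∫ x, ‖χ x‖ ^ 2 := integral_norm_sq_schwartz_pos hχ₀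
  refine ⟨1 / 2 * (min 1 (10 ^ (-k / 2)) * ∫ x, ‖χ x‖ ^ 2) /
    (eLpNorm (𝓕 ψ : 𝓢(𝔼 d, ℂ)) r volume).toReal, by positivity, (eLpNorm χ 2 volume).toReal,
    fun l hl ↦ ?_⟩
  have hl₀ : 0 < l := one_pos.trans_le hl
  obtain ⟨u, hu⟩ := exists_fourier_besselL2_ae_eq k
    (((dilate hl₀.ne' χ).memLp 2 volume).mul (phase_memLp P (-t₀)) (hpqr := inferInstance))
  refine ⟨u, ?_, fun t ht ↦ ?_⟩
  · rw [sobolevNorm_eq_of_fourier_ae_eq_phase_mul_dilate hl₀.ne' hu, abs_of_pos hl₀]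
  · exact ofReal_mul_rpow_le_lqNorm_of_le_norm_fourier_dilate hl₀ hψ
      (mul_rpow_le_norm_freeFlow_fourier_dilate_conjSchwartz hχ hl hu ht)

end WavePacket

end ModifiedDispersion

open ModifiedDispersion in
theorem corollary1_general {d : ℕ} (hd : 1 ≤ d)
    (P : Lp ℝ ∞ (volume : Measure (EuclideanSpace ℝ (Fin d)))) {p q : ℝ≥0∞} (hp : p ≠ 0)
    (hq : 1 ≤ q) {k : ℝ} {I : Set ℝ} (hI : volume I ≠ 0) {C : ℝ}
    (hS : ∀ u : SobolevH d k,
      strichartzNorm p q I (fun t ↦ freeFlow P t u) ≤ ENNReal.ofReal (C * sobolevNorm u)) :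
    (d : ℝ) / 2 - d * (q⁻¹).toReal ≤ k := by
  obtain ⟨t₀, J, hJ, hJ₀, hJ_top, hJt⟩ :=
    exists_measurableSet_restrict_ne_zero_abs_sub_mul_le_one hI (norm_nonneg P)
  obtain ⟨a, ha, M, hwave⟩ := exists_sobolevNorm_eq_and_le_lqNorm_freeFlow hd P k hq t₀
  let m := volume.restrict I J ^ (1 / p.toReal)
  have hm_top : m ≠ ∞ := ENNReal.rpow_ne_top_of_nonneg (by positivity) hJ_top
  have hm : 0 < m.toReal := ENNReal.toReal_pos (ENNReal.rpow_pos hJ₀.bot_lt hJ_top).ne' hm_top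
  suffices d - k - d * (q⁻¹).toReal ≤ (d : ℝ) / 2 by linarith
  refine exponent_le_of_forall_mul_rpow_le (mul_pos ha hm) (b := C * M) fun l hl ↦ ?_
  obtain ⟨u, hu, hflow⟩ := hwave l hl
  have hbound : ENNReal.ofReal (a * m.toReal * l ^ (d - k - d * (q⁻¹).toReal)) ≤
      ENNReal.ofReal (C * M * l ^ ((d : ℝ) / 2)) := by
    calc ENNReal.ofReal (a * m.toReal * l ^ (d - k - d * (q⁻¹).toReal))
        = ENNReal.ofReal (a * l ^ (d - k - d * (q⁻¹).toReal)) * m := by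
          rw [mul_right_comm, ENNReal.ofReal_mul (by positivity), ENNReal.ofReal_toReal hm_top]
      _ ≤ strichartzNorm p q I (fun t ↦ freeFlow P t u) :=
          mul_measure_rpow_le_eLpNorm hp hJ hJ₀ fun t ht ↦ hflow t (hJt t ht)
      _ ≤ ENNReal.ofReal (C * M * l ^ ((d : ℝ) / 2)) := by
          rw [mul_assoc, ← hu]
          exact hS u
  refine (ENNReal.ofReal_le_ofReal_iff'.mp hbound).resolve_right (not_le.mpr ?_)
  positivity

theorem corollary1 (d : ℕ) (hd : 1 ≤ d)
    (P : MeasureTheory.Lp ℝ ∞ (MeasureTheory.volume : Measure (EuclideanSpace ℝ (Fin d))))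
    (p q : ℝ≥0∞) (hpq : ModifiedDispersion.IsAdmissible d p q) (k : ℝ)
    (I : Set ℝ) (hI : I.OrdConnected) (h0 : (0 : ℝ) ∈ I) (hIpos : 0 < volume I)
    (C : ℝ) (hC : 0 < C)
    (hS : ∀ u₀ : ModifiedDispersion.SobolevH d k,
      ModifiedDispersion.strichartzNorm p q I (fun t ↦ ModifiedDispersion.freeFlow P t u₀) ≤
        ENNReal.ofReal (C * ModifiedDispersion.sobolevNorm u₀)) :
    2 * (p⁻¹).toReal ≤ k ∧ 2 * (p⁻¹).toReal = (d : ℝ) / 2 - d * (q⁻¹).toReal := by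
  have hscaling : 2 * (p⁻¹).toReal = (d : ℝ) / 2 - d * (q⁻¹).toReal := by
    rw [hpq.scaling]
    ring
  have hp : p ≠ 0 := (two_pos.trans_le hpq.two_le_left).ne'
  have hq : 1 ≤ q := one_le_two.trans hpq.two_le_right
  exact ⟨hscaling.trans_le (corollary1_general hd P hp hq hIpos.ne' hS), hscaling⟩
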